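/- The two-dimensional Sierpinski gasket $SG(n)$, $n\ge 0$, is the following graph, with vertices written in triangular-lattice coordinates $(i,j)\in\mathbb{N}^2$. $SG(0)$ is the triangle with vertices $(0,0),(1,0),(0,1)$, and $SG(n+1)$ is the union of $SG(n)$ and of its two translates by $(2^n,0)$ and $(0,2^n)$. For $n\ge 0$ put $a_n=(2^n,0)$, $b_n=(0,2^n)$ and $c_n=(2^n,2^n)$; thus $a_n,b_n$ are the outmost vertices of $SG(n)$ other than $(0,0)$, and $a_n,b_n,c_n$ are the three points at which the three copies of $SG(n)$ in $SG(n+1)$ meet. For a vertex $x$ of $SG(n)$ and $j\in\{1,2,3,4\}$ let $$F_j(n,x)=\frac{f_j(n,x)}{f(n)},$$ where $f(n)$ is the number of spanning trees of $SG(n)$ and $f_j(n,x)$ is the number of those spanning trees in which $x$ has degree exactly $j$. Let $m\ge 0$ be an integer and, for every $n\ge 0$, let $x_n$ be any one of the vertices $a_n,b_n,c_n$, regarded as a vertex of $SG(n+m+1)$. Then $$\lim_{n\to\infty}F_1(n+m+1,x_n)=0,\qquad \lim_{n\to\infty}F_2(n+m+1,x_n)=\frac{121}{196},$$ $$\lim_{n\to\infty}F_3(n+m+1,x_n)=\frac{33}{98},\qquad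 \lim_{n\to\infty}F_4(n+m+1,x_n)=\frac{9}{196}.$$ -/

import Mathlib

open Filter Topology

namespace SierpinskiGasket

/-- Vertices of the stage-`n` gasket, in the coordinates `(i, j)` of a triangular lattice (the
two coordinate axes point along two sides of the gasket at its leftmost corner `(0, 0)`).
Stage `0` is a triangle; stage `n + 1` is the union of stage `n` and of its translates by
`(2 ^ n, 0)` and `(0, 2 ^ n)`. -/
def verts : ℕ → Finset (ℕ × ℕ)
  | 0 => {(0, 0), (1, 0), (0, 1)}
  | n + 1 => verts n ∪ (verts n).map (addRightEmbedding (2 ^ n, 0)) ∪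
      (verts n).map (addRightEmbedding (0, 2 ^ n))

/-- The bonds of the stage-`n` gasket, as a graph on the whole lattice. -/
def bonds : ℕ → SimpleGraph (ℕ × ℕ)
  | 0 => SimpleGraph.fromEdgeSet
      {s((0, 0), (1, 0)), s((0, 0), (0, 1)), s((1, 0), (0, 1))}
  | n + 1 => bonds n ⊔ (bonds n).map (addRightEmbedding (2 ^ n, 0)) ⊔
      (bonds n).map (addRightEmbedding (0, 2 ^ n))

/-- The vertex set `V(SG(n))` as a type. -/
abbrev Vertex (n : ℕ) : Type := {p : ℕ × ℕ // p ∈ verts n}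

/-- The two-dimensional Sierpinski gasket `SG(n)`. -/
def SG (n : ℕ) : SimpleGraph (Vertex n) := (bonds n).comap Subtype.val

/-- `T` is a spanning tree of `G`. -/
def IsSpanningTree {V : Type*} (G T : SimpleGraph V) : Prop := T ≤ G ∧ T.IsTree

/-- `f(n)`: the number of spanning trees of `SG(n)`. -/
noncomputable def numTrees (n : ℕ) : ℕ :=
  {T : SimpleGraph (Vertex n) | IsSpanningTree (SG n) T}.ncard

open Classical in
/-- `f_j(n, x)`: the number of spanning trees of `SG(n)` with exactly `j` bonds at `x`. -/
noncomputable def numTreesDeg (j n : ℕ) (x : Vertex n) : ℕ :=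
  {T : SimpleGraph (Vertex n) | IsSpanningTree (SG n) T ∧ T.degree x = j}.ncard

/-- `F_j(n, x) = f_j(n, x) / f(n)`. -/
noncomputable def degProb (j n : ℕ) (x : Vertex n) : ℝ :=
  (numTreesDeg j n x : ℝ) / (numTrees n : ℝ)

theorem verts_mono {m n : ℕ} (h : m ≤ n) : verts m ⊆ verts n := by
  induction n, h using Nat.le_induction with
  | base => exact Finset.Subset.refl _
  | succ n _ ih =>
    intro p hp
    simp only [verts, Finset.mem_union]
    exact Or.inl (Or.inl (ih hp))

theorem corners_mem (n : ℕ) :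
    (0, 0) ∈ verts n ∧ (2 ^ n, 0) ∈ verts n ∧ (0, 2 ^ n) ∈ verts n := by
  induction n with
  | zero => simp [verts]
  | succ n ih =>
    obtain ⟨h0, h1, h2⟩ := ih
    refine ⟨?_, ?_, ?_⟩
    · simp only [verts, Finset.mem_union]
      exact Or.inl (Or.inl h0)
    · simp only [verts, Finset.mem_union]
      refine Or.inl (Or.inr (Finset.mem_map.2 ⟨(2 ^ n, 0), h1, ?_⟩))
      simp [pow_succ, mul_two]
    · simp only [verts, Finset.mem_union]
      refine Or.inr (Finset.mem_map.2 ⟨(0, 2 ^ n), h2, ?_⟩)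
      simp [pow_succ, mul_two]

theorem mid_mem (n : ℕ) : (2 ^ n, 2 ^ n) ∈ verts (n + 1) := by
  simp only [verts, Finset.mem_union]
  refine Or.inr (Finset.mem_map.2 ⟨(2 ^ n, 0), (corners_mem n).2.1, ?_⟩)
  simp

/-- `a_n`, the rightmost vertex of `SG(n)`, as a vertex of `SG(n + m + 1)`. -/
def vertexA (n m : ℕ) : Vertex (n + m + 1) :=
  ⟨(2 ^ n, 0), verts_mono (by omega) (corners_mem n).2.1⟩

/-- `b_n`, the topmost vertex of `SG(n)`, as a vertex of `SG(n + m + 1)`. -/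
def vertexB (n m : ℕ) : Vertex (n + m + 1) :=
  ⟨(0, 2 ^ n), verts_mono (by omega) (corners_mem n).2.2⟩

/-- `c_n`, the third vertex of the largest lacunary triangle of `SG(n + 1)` (its other two
vertices are `a_n` and `b_n`), as a vertex of `SG(n + m + 1)`. -/
def vertexC (n m : ℕ) : Vertex (n + m + 1) :=
  ⟨(2 ^ n, 2 ^ n), verts_mono (by omega) (mid_mem n)⟩

end SierpinskiGasket

/-! A spanning tree of one stage restricts, on each of the three copies of the stage before, to a
spanning forest all of whose components contain a corner. So forests are counted for all five
partitions (types) of the corners at once. Acyclicity is expressed by an edge count, because edge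
counts add under gluing. By `isForest_glue_iff`, a glued subgraph is a forest of type `τ` exactly
when the types of its pieces form a triple in the finite set `good τ`. This gives recursions whose
coefficients do not depend on the stage.

Triples in `good τ` have a fixed total number of blocks, and the weighted counts `total τ` are again
geometric in the number of blocks, up to `weight τ`. The shape `F * r ^ blocks τ * weight τ`
therefore reproduces itself (`exists_numForests_eq`). Hence the types of the copies in a uniformly
random forest have a law independent of the stage (`prod_numForests`).

The degree of a corner is decided inside one copy, so its law given the type evolves by a fixed
stochastic matrix (`forestProb_corner_succ`). The types joining the corner to another one form a
closed class, with stationary mass 9/14 on the single block and 5/14 on the rest. The other two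
types are transient. From the values on the triangle, every type has the same limit: degree 1 with
probability (9 * 2/3 + 5)/14 = 11/14, degree 2 with probability 3/14 (`tendsto_forestProb_corner`).

Where two copies meet, the degree is a sum of two corner degrees, independent given the types. Since
their limits do not depend on the types, the limit law is a convolution (`tendsto_forestProb_mid`).
Passing to larger gaskets only averages over types (`tendsto_forestProb_mid_add`), and spanning
trees are the forests of type `0` (`isForest_map_iff`). -/

namespace SierpinskiGasket

/-! ### Partitions of the three corners

The five partitions of the three corners are encoded by `Fin 5`: `0` has one block, `4` has three,
and `i + 1` separates the corner `i` from the two others. -/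

/-- The corners `x` and `y` lie in the same block of the partition `τ`. -/
def same (τ : Fin 5) (x y : Fin 3) : Bool :=
  x == y || τ == 0 || (τ != 4 && x.val + 1 != τ.val && y.val + 1 != τ.val)

/-- The number of blocks of a partition. -/
def blocks (τ : Fin 5) : ℕ := if τ = 0 then 1 else if τ = 4 then 3 else 2

theorem same_refl (τ : Fin 5) (x : Fin 3) : same τ x x = true := by simp [same]

theorem same_injective : ∀ τ σ : Fin 5, (∀ x y, same τ x y = same σ x y) → τ = σ := by decide

/-- Every equivalence relation on the corners is one of the five. -/
theorem exists_same_iff (r : Fin 3 → Fin 3 → Prop) (h : Equivalence r) :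
    ∃ τ, ∀ x y, r x y ↔ same τ x y = true := by
  have h10 : r 1 0 ↔ r 0 1 := ⟨h.symm, h.symm⟩
  have h20 : r 2 0 ↔ r 0 2 := ⟨h.symm, h.symm⟩
  have h21 : r 2 1 ↔ r 1 2 := ⟨h.symm, h.symm⟩
  have h012 : r 0 1 → r 1 2 → r 0 2 := h.trans
  have h021 : r 0 2 → r 1 2 → r 0 1 := fun a b => h.trans a (h.symm b)
  have h102 : r 0 1 → r 0 2 → r 1 2 := fun a b => h.trans (h.symm a) b
  by_cases a : r 0 1 <;> by_cases b : r 0 2 <;> by_cases c : r 1 2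
  · exact ⟨0, by simp [Fin.forall_fin_succ, same, h10, h20, h21, h.refl, a, b, c]⟩
  · exact absurd (h102 a b) c
  · exact absurd (h012 a c) b
  · exact ⟨3, by simp [Fin.forall_fin_succ, same, h10, h20, h21, h.refl, a, b, c]⟩
  · exact absurd (h021 b c) a
  · exact ⟨2, by simp [Fin.forall_fin_succ, same, h10, h20, h21, h.refl, a, b, c]⟩
  · exact ⟨1, by simp [Fin.forall_fin_succ, same, h10, h20, h21, h.refl, a, b, c]⟩
  · exact ⟨4, by simp [Fin.forall_fin_succ, same, h10, h20, h21, h.refl, a, b, c]⟩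

/-! ### Gluing three partitions

Three copies of a triangle, with partitions `t 0`, `t 1`, `t 2` of their corners, are glued so that
the corner `j` of the copy `i` is the corner `i` of the copy `j`. The pair `(i, j)` stands for the
corner `j` of the copy `i`. -/

/-- Corners in the same block of a copy, the second one being read in the copy across. -/
def Link (t : Fin 3 → Fin 5) (a b : Fin 3 × Fin 3) : Prop :=
  same (t a.1) a.2 b.1 = true ∧ b.2 = a.1

/-- Connectedness in the glued triangles. -/
def Linked (t : Fin 3 → Fin 5) : Fin 3 × Fin 3 → Fin 3 × Fin 3 → Prop :=
  Relation.ReflTransGen (Link t)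

theorem link_swap (t : Fin 3 → Fin 5) (i j : Fin 3) : Link t (i, j) (j, i) :=
  ⟨same_refl _ _, rfl⟩

/-- A link always ends in the copy across, so staying in the copy means crossing at `k` and coming
back. -/
theorem linked_of_same {t : Fin 3 → Fin 5} {i j k : Fin 3} (h : same (t i) j k = true) :
    Linked t (i, j) (i, k) :=
  (Relation.ReflTransGen.single (show Link t (i, j) (k, i) from ⟨h, rfl⟩)).tail (link_swap t k i)

/-- The position of a corner in a bit mask. -/
def bit (a : Fin 3 × Fin 3) : ℕ := 3 * a.1 + a.2

/-- The bit mask of the successors of a corner under `Link`. -/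
def successors (τ : Fin 5) (a : Fin 3 × Fin 3) : ℕ :=
  (if same τ a.2 0 then 2 ^ bit (0, a.1) else 0) +
  (if same τ a.2 1 then 2 ^ bit (1, a.1) else 0) +
  (if same τ a.2 2 then 2 ^ bit (2, a.1) else 0)

/-- Add the successors of `a` to a bit mask that holds `a`. -/
def absorb (t : Fin 3 → Fin 5) (s : ℕ) (a : Fin 3 × Fin 3) : ℕ :=
  if s.testBit (bit a) then s ||| successors (t a.1) a else s

/-- The nine corners, repeated as often as an exploration of the glued triangles needs. -/
def schedule : List (Fin 3 × Fin 3) :=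
  (List.replicate 5 [(0, 0), (1, 1), (2, 2), (0, 1), (1, 0), (0, 2), (2, 0), (1, 2), (2, 1)]).flatten

/-- The bit mask of the corners connected to the outer corner `x`. -/
def component (t : Fin 3 → Fin 5) (x : Fin 3) : ℕ :=
  schedule.foldl (absorb t) (2 ^ bit (x, x))

theorem bit_injective : Function.Injective bit := by
  intro a b; revert a b; decide

theorem testBit_successors : ∀ (τ : Fin 5) (a b : Fin 3 × Fin 3),
    (successors τ a).testBit (bit b) = (same τ a.2 b.1 && b.2 == a.1) := by decide +kernel

/-- Soundness of the exploration: absorbing only adds successors of corners already reached,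
whatever the schedule. -/
theorem linked_of_testBit_foldl {t : Fin 3 → Fin 5} {o : Fin 3 × Fin 3} (l : List (Fin 3 × Fin 3)) :
    ∀ s : ℕ, (∀ a, s.testBit (bit a) = true → Linked t o a) →
      ∀ a, (l.foldl (absorb t) s).testBit (bit a) = true → Linked t o a := by
  induction l with
  | nil => exact fun s h => h
  | cons c l ih =>
    intro s h
    refine ih _ fun a ha => ?_
    unfold absorb at ha
    split_ifs at ha with hc
    · rw [Nat.testBit_or, Bool.or_eq_true, testBit_successors, Bool.and_eq_true, beq_iff_eq] at ha
      rcases ha with ha | ha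
      · exact h a ha
      · exact (h c hc).tail ha
    · exact h a ha

/-- To quantify over triples of partitions, quantify over their entries. -/
theorem forall_partition_triple {p : (Fin 3 → Fin 5) → Prop} (h : ∀ a b c, p ![a, b, c])
    (t : Fin 3 → Fin 5) : p t := by
  have : t = ![t 0, t 1, t 2] := by ext i; fin_cases i <;> rfl
  rw [this]; exact h _ _ _

/-- Completeness of the exploration: the schedule is long enough for the mask to be stable under
every further `absorb`. This is evaluated on all 125 triples. -/
theorem component_closed : ∀ (t : Fin 3 → Fin 5) (x : Fin 3) (a : Fin 3 × Fin 3),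
    absorb t (component t x) a = component t x ∧ (component t x).testBit (bit (x, x)) = true := by
  refine forall_partition_triple ?_
  decide +kernel

theorem testBit_component {t : Fin 3 → Fin 5} {x : Fin 3} {a : Fin 3 × Fin 3} :
    (component t x).testBit (bit a) = true ↔ Linked t (x, x) a := by
  constructor
  · refine linked_of_testBit_foldl _ _ (fun b hb => ?_) a
    rw [Nat.testBit_two_pow, decide_eq_true_eq] at hb
    rw [bit_injective hb]
    exact Relation.ReflTransGen.refl
  · intro h
    induction h with
    | refl => exact (component_closed t x (x, x)).2
    | @tail b c _ hbc ih =>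
      have h := (component_closed t x b).1
      rw [absorb, if_pos ih] at h
      rw [← h, Nat.testBit_or, Bool.or_eq_true, testBit_successors]
      right
      simpa [Link] using hbc

/-- Every corner of the glued triangles is connected to an outer one. -/
def Covers (t : Fin 3 → Fin 5) : Prop := ∀ a, ∃ x, Linked t (x, x) a

/-- The outer corners of the glued triangles are partitioned by `τ`. -/
def Glues (t : Fin 3 → Fin 5) (τ : Fin 5) : Prop :=
  ∀ x y, Linked t (x, x) (y, y) ↔ same τ x y = true

/-- The gluing gives `τ`, leaves no component inside, and closes no cycle. -/
def goodB (τ : Fin 5) (t : Fin 3 → Fin 5) : Bool :=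
  ((component t 0 ||| component t 1 ||| component t 2) == 511) &&
  decide (∀ x y, (component t x).testBit (bit (y, y)) = same τ x y) &&
  (blocks (t 0) + blocks (t 1) + blocks (t 2) == blocks τ + 3)

/-- The triples of partitions that glue to `τ` without cycles. -/
def good (τ : Fin 5) : Finset (Fin 3 → Fin 5) := Finset.univ.filter fun t => goodB τ t = true

theorem component_union : ∀ (t : Fin 3 → Fin 5),
    (component t 0 ||| component t 1 ||| component t 2) = 511 ↔
      ∀ a, ∃ x, (component t x).testBit (bit a) = true := by
  refine forall_partition_triple ?_
  decide +kernel

theorem covers_iff {t : Fin 3 → Fin 5} :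
    Covers t ↔ (component t 0 ||| component t 1 ||| component t 2) = 511 := by
  simp only [component_union, testBit_component, Covers]

theorem glues_iff {t : Fin 3 → Fin 5} {τ : Fin 5} :
    Glues t τ ↔ ∀ x y, (component t x).testBit (bit (y, y)) = same τ x y := by
  refine forall₂_congr fun x y => ?_
  rw [← testBit_component]
  exact Bool.eq_iff_iff.symm

theorem mem_good {t : Fin 3 → Fin 5} {τ : Fin 5} :
    t ∈ good τ ↔ Covers t ∧ Glues t τ ∧ ∑ i, blocks (t i) = blocks τ + 3 := by
  simp [good, goodB, covers_iff, glues_iff, Fin.sum_univ_three, and_assoc]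

/-- Three identifications of points glue the copies, and each lowers the number of components by one
unless it closes a cycle. The covering condition ensures that `τ` sees all the components that
remain. The proof is an enumeration. -/
theorem sum_blocks_le_aux : ∀ (t : Fin 3 → Fin 5) (τ : Fin 5),
    (component t 0 ||| component t 1 ||| component t 2) = 511 →
    (∀ x y, (component t x).testBit (bit (y, y)) = same τ x y) →
    blocks (t 0) + blocks (t 1) + blocks (t 2) ≤ blocks τ + 3 := by
  refine forall_partition_triple ?_
  decide +kernel

theorem sum_blocks_le {t : Fin 3 → Fin 5} {τ : Fin 5} (h : Covers t) (h' : Glues t τ) :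
    ∑ i, blocks (t i) ≤ blocks τ + 3 := by
  rw [Fin.sum_univ_three]
  exact sum_blocks_le_aux t τ (covers_iff.1 h) (glues_iff.1 h')

/-- Relative weights of the partitions. -/
def weight (τ : Fin 5) : ℕ := if τ = 4 then 3 else 1

/-- The total weight of the gluings to `τ`. -/
def total (τ : Fin 5) : ℕ := if τ = 0 then 6 else if τ = 4 then 50 else 10

/-- The weight of the gluings to `τ` whose copy `i` has the partition `σ`. -/
def transfer (i : Fin 3) (τ σ : Fin 5) : ℕ :=
  ∑ t ∈ good τ, if t i = σ then ∏ k, weight (t k) else 0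

/-- Nested sums over the entries are the form in which the kernel evaluates `transfer_eq` and
`sum_weight_good`. -/
theorem sum_good_eq (τ : Fin 5) (φ : (Fin 3 → Fin 5) → ℕ) :
    ∑ t ∈ good τ, φ t =
      ∑ a : Fin 5, ∑ b : Fin 5, ∑ c : Fin 5,
        if goodB τ ![a, b, c] = true then φ ![a, b, c] else 0 := by
  rw [good, Finset.sum_filter]
  let e : Fin 5 × Fin 5 × Fin 5 ≃ (Fin 3 → Fin 5) :=
    { toFun := fun p => ![p.1, p.2.1, p.2.2]
      invFun := fun t => (t 0, t 1, t 2)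
      left_inv := fun p => rfl
      right_inv := fun t => by ext i; fin_cases i <;> rfl }
  rw [← e.sum_comp]
  simp only [Fintype.sum_prod_type]
  rfl

/-- The values of `transfer`. -/
def transferTable (i : Fin 3) (τ σ : Fin 5) : ℕ :=
  if τ = 0 then
    if σ = 0 then 4 else if σ = 4 ∨ σ.val = i.val + 1 then 0 else 1
  else if τ = 4 then
    if σ = 0 ∨ σ = 4 ∨ σ.val = i.val + 1 then 12 else 7
  else if τ.val = i.val + 1 then
    if σ = 0 then 1 else if σ = 4 then 3 else if σ = τ then 4 else 1
  else
    if σ = 0 then 6 else if σ = 4 ∨ σ.val = i.val + 1 then 0 else if σ = τ then 3 else 1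

theorem transfer_eq : ∀ (i : Fin 3) (τ σ : Fin 5), transfer i τ σ = transferTable i τ σ := by
  simp only [transfer, sum_good_eq]
  decide +kernel

theorem sum_weight_good : ∀ τ : Fin 5, ∑ t ∈ good τ, ∏ k, weight (t k) = total τ := by
  simp only [sum_good_eq]
  decide +kernel

/-! ### Corners and copies -/

/-- The outmost vertices of the stage-`n` gasket. -/
def corner (n : ℕ) (i : Fin 3) : ℕ × ℕ := ![(0, 0), (2 ^ n, 0), (0, 2 ^ n)] i

/-- The translation that takes the stage-`n` gasket to its copy `i` in the next stage. -/
def shift (n : ℕ) (i : Fin 3) : ℕ × ℕ ↪ ℕ × ℕ := addRightEmbedding (corner n i)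

theorem shift_apply (n : ℕ) (i : Fin 3) (p : ℕ × ℕ) : shift n i p = p + corner n i := rfl

theorem shift_zero (n : ℕ) (p : ℕ × ℕ) : shift n 0 p = p := by simp [shift_apply, corner]

theorem shift_corner_comm (n : ℕ) (i j : Fin 3) :
    shift n i (corner n j) = shift n j (corner n i) := by
  simp only [shift_apply, add_comm]

theorem corner_succ (n : ℕ) (i : Fin 3) : corner (n + 1) i = shift n i (corner n i) := by
  fin_cases i <;> simp [shift_apply, corner, pow_succ, mul_two]

theorem corner_injective (n : ℕ) : Function.Injective (corner n) := by
  intro i j h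
  have h0 := Nat.two_pow_pos n
  fin_cases i <;> fin_cases j <;> first | rfl | (simp [corner] at h <;> omega)

theorem corner_mem (n : ℕ) (i : Fin 3) : corner n i ∈ verts n := by
  obtain ⟨h0, h1, h2⟩ := corners_mem n
  fin_cases i
  exacts [h0, h1, h2]

theorem mem_verts_succ {n : ℕ} {p : ℕ × ℕ} :
    p ∈ verts (n + 1) ↔ ∃ i, ∃ q ∈ verts n, shift n i q = p := by
  obtain ⟨a, b⟩ := p
  simp [verts, Fin.exists_fin_succ, shift, corner]

theorem bonds_succ (n : ℕ) : bonds (n + 1) = ⨆ i, (bonds n).map (shift n i) := by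
  ext u v
  obtain ⟨a, b⟩ := u
  obtain ⟨c, d⟩ := v
  simp [bonds, shift, corner, or_assoc]

theorem mem_verts_of_adj {n : ℕ} {u v : ℕ × ℕ} (h : (bonds n).Adj u v) : u ∈ verts n := by
  induction n generalizing u v with
  | zero =>
    simp only [bonds, SimpleGraph.fromEdgeSet_adj] at h
    simp only [verts]
    aesop
  | succ n ih =>
    rw [bonds_succ, SimpleGraph.iSup_adj] at h
    obtain ⟨i, h⟩ := h
    rw [SimpleGraph.map_adj] at h
    obtain ⟨u', v', h, rfl, rfl⟩ := h
    exact mem_verts_succ.2 ⟨i, u', ih h, rfl⟩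

/-- Lying in this large triangle is all that is needed to see that two copies meet in a single
point. -/
theorem add_le_of_mem_verts {n : ℕ} {p : ℕ × ℕ} (h : p ∈ verts n) : p.1 + p.2 ≤ 2 ^ n := by
  induction n generalizing p with
  | zero =>
    simp only [verts] at h
    aesop
  | succ n ih =>
    obtain ⟨i, q, hq, rfl⟩ := mem_verts_succ.1 h
    have := ih hq
    have h2 : 2 ^ (n + 1) = 2 ^ n + 2 ^ n := by ring
    fin_cases i <;> simp [shift_apply, corner] <;> omega

/-- Two copies meet in a corner of each. -/
theorem eq_corner_of_shift_eq {n : ℕ} {i j : Fin 3} (hij : i ≠ j) {p q : ℕ × ℕ} (hp : p ∈ verts n)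
    (hq : q ∈ verts n) (h : shift n i p = shift n j q) : p = corner n j ∧ q = corner n i := by
  have h1 := add_le_of_mem_verts hp
  have h2 := add_le_of_mem_verts hq
  obtain ⟨a, b⟩ := p
  obtain ⟨c, d⟩ := q
  fin_cases i <;> fin_cases j <;> simp_all [shift_apply, corner] <;> omega

theorem finite_edgeSet_bonds (n : ℕ) : (bonds n).edgeSet.Finite := by
  induction n with
  | zero =>
    refine Set.Finite.subset (s := {s((0, 0), (1, 0)), s((0, 0), (0, 1)), s((1, 0), (0, 1))})
      (by simp) ?_
    simp only [bonds, SimpleGraph.edgeSet_fromEdgeSet]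
    exact Set.sdiff_subset
  | succ n ih =>
    rw [bonds, SimpleGraph.edgeSet_sup, SimpleGraph.edgeSet_sup, SimpleGraph.edgeSet_map,
      SimpleGraph.edgeSet_map]
    exact (ih.union (ih.image _)).union (ih.image _)

theorem finite_edgeSet {n : ℕ} {S : SimpleGraph (ℕ × ℕ)} (h : S ≤ bonds n) : S.edgeSet.Finite :=
  (finite_edgeSet_bonds n).subset (SimpleGraph.edgeSet_mono h)

theorem finite_Iic_bonds (n : ℕ) : {S | S ≤ bonds n}.Finite := by
  refine Set.Finite.of_finite_image (f := SimpleGraph.edgeSet) ?_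
    (SimpleGraph.edgeSet_injective.injOn)
  refine (finite_edgeSet_bonds n).finite_subsets.subset ?_
  rintro _ ⟨S, hS, rfl⟩
  exact SimpleGraph.edgeSet_mono hS

theorem mem_verts_of_reachable {n : ℕ} {S : SimpleGraph (ℕ × ℕ)} (hS : S ≤ bonds n) {u v : ℕ × ℕ}
    (hu : u ∈ verts n) (h : S.Reachable u v) : v ∈ verts n := by
  rw [SimpleGraph.reachable_iff_reflTransGen] at h
  induction h with
  | refl => exact hu
  | tail _ h _ => exact mem_verts_of_adj (hS h).symm

/-- Each of the three points where two copies meet is counted twice in the three copies. -/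
theorem card_verts_succ (n : ℕ) : (verts (n + 1)).card + 3 = 3 * (verts n).card := by
  have key : ∀ i j : Fin 3, i ≠ j →
      (verts n).map (shift n i) ∩ (verts n).map (shift n j) = {shift n i (corner n j)} := by
    intro i j hij
    ext p
    simp only [Finset.mem_inter, Finset.mem_map, Finset.mem_singleton]
    constructor
    · rintro ⟨⟨q, hq, rfl⟩, r, hr, h⟩
      rw [(eq_corner_of_shift_eq hij hq hr h.symm).1]
    · rintro rfl
      exact ⟨⟨_, corner_mem n j, rfl⟩, _, corner_mem n i, shift_corner_comm n j i⟩
  have hv : verts (n + 1) = (verts n).map (shift n 0) ∪ (verts n).map (shift n 1) ∪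
      (verts n).map (shift n 2) := by
    ext p
    simp [mem_verts_succ, Fin.exists_fin_succ]
  have h1 := Finset.card_union_add_card_inter ((verts n).map (shift n 0)) ((verts n).map (shift n 1))
  have h2 := Finset.card_union_add_card_inter
    ((verts n).map (shift n 0) ∪ (verts n).map (shift n 1)) ((verts n).map (shift n 2))
  rw [Finset.union_inter_distrib_right, key 0 2 (by decide), key 1 2 (by decide),
    Finset.card_union_of_disjoint (s := {_}), Finset.card_singleton, Finset.card_singleton,
    ← hv] at h2
  · rw [key 0 1 (by decide), Finset.card_singleton] at h1
    simp only [Finset.card_map] at h1 h2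
    omega
  · rw [Finset.disjoint_singleton]
    intro h
    rw [shift_corner_comm n 0 2, shift_corner_comm n 1 2] at h
    exact absurd (corner_injective n ((shift n 2).injective h)) (by decide)

/-! ### Gluing subgraphs -/

/-- The union of subgraphs of the three copies of the stage-`n` gasket. -/
def glue (n : ℕ) (S : Fin 3 → SimpleGraph (ℕ × ℕ)) : SimpleGraph (ℕ × ℕ) :=
  ⨆ i, (S i).map (shift n i)

/-- The part of a subgraph in the copy `i` of the stage-`n` gasket. -/
def piece (n : ℕ) (G : SimpleGraph (ℕ × ℕ)) (i : Fin 3) : SimpleGraph (ℕ × ℕ) :=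
  G.comap (shift n i) ⊓ bonds n

theorem glue_adj {n : ℕ} {S : Fin 3 → SimpleGraph (ℕ × ℕ)} {u v : ℕ × ℕ} :
    (glue n S).Adj u v ↔ ∃ i u' v', (S i).Adj u' v' ∧ shift n i u' = u ∧ shift n i v' = v := by
  simp only [glue, SimpleGraph.iSup_adj, SimpleGraph.map_adj]

theorem glue_le {n : ℕ} {S : Fin 3 → SimpleGraph (ℕ × ℕ)} (h : ∀ i, S i ≤ bonds n) :
    glue n S ≤ bonds (n + 1) := by
  rw [bonds_succ]
  exact iSup_mono fun i => SimpleGraph.map_monotone _ (h i)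

theorem glue_piece {n : ℕ} {G : SimpleGraph (ℕ × ℕ)} (h : G ≤ bonds (n + 1)) :
    glue n (piece n G) = G := by
  ext u v
  rw [glue_adj]
  constructor
  · rintro ⟨i, u', v', ⟨h, -⟩, rfl, rfl⟩
    exact h
  · intro huv
    have := h huv
    rw [bonds_succ, SimpleGraph.iSup_adj] at this
    obtain ⟨i, hi⟩ := this
    rw [SimpleGraph.map_adj] at hi
    obtain ⟨u', v', hi, rfl, rfl⟩ := hi
    exact ⟨i, u', v', ⟨huv, hi⟩, rfl, rfl⟩

/-- No bond lies in two copies: both its ends would be the one point where the copies meet. With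
`glue_piece`, this makes gluing a bijection. -/
theorem piece_glue {n : ℕ} {S : Fin 3 → SimpleGraph (ℕ × ℕ)} (h : ∀ i, S i ≤ bonds n) :
    piece n (glue n S) = S := by
  ext i u v
  simp only [piece, SimpleGraph.inf_adj, SimpleGraph.comap_adj, glue_adj]
  constructor
  · rintro ⟨⟨j, u', v', hj, hu, hv⟩, huv⟩
    by_cases hij : j = i
    · subst hij
      rwa [(shift n j).injective hu, (shift n j).injective hv] at hj
    · have hu' := eq_corner_of_shift_eq hij (mem_verts_of_adj (h j hj)) (mem_verts_of_adj huv) hu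
      have hv' := eq_corner_of_shift_eq hij (mem_verts_of_adj (h j hj).symm)
        (mem_verts_of_adj huv.symm) hv
      exact absurd (hu'.2.trans hv'.2.symm) huv.ne
  · intro hi
    exact ⟨⟨i, u, v, hi, rfl, rfl⟩, h i hi⟩

theorem piece_le (n : ℕ) (G : SimpleGraph (ℕ × ℕ)) (i : Fin 3) : piece n G i ≤ bonds n :=
  inf_le_right

theorem edgeSet_glue (n : ℕ) (S : Fin 3 → SimpleGraph (ℕ × ℕ)) :
    (glue n S).edgeSet = ⋃ i, (shift n i).sym2Map '' (S i).edgeSet := by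
  ext e
  induction e with
  | _ u v =>
  simp only [SimpleGraph.mem_edgeSet, glue, SimpleGraph.iSup_adj, Set.mem_iUnion,
    ← SimpleGraph.edgeSet_map]

theorem ncard_edgeSet_glue {n : ℕ} {S : Fin 3 → SimpleGraph (ℕ × ℕ)} (h : ∀ i, S i ≤ bonds n) :
    (glue n S).edgeSet.ncard = ∑ i, (S i).edgeSet.ncard := by
  rw [edgeSet_glue, ← finsum_eq_sum_of_fintype]
  rw [Set.ncard_iUnion_of_finite (fun i => (finite_edgeSet (h i)).image _)]
  · exact finsum_congr fun i => Set.ncard_image_of_injective _ (shift n i).sym2Map.injective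
  · intro i j hij
    rw [Function.onFun, Set.disjoint_left]
    rintro _ ⟨e, he, rfl⟩ ⟨e', he', hee⟩
    induction e with
    | _ u v =>
    induction e' with
    | _ u' v' =>
    rw [SimpleGraph.mem_edgeSet] at he he'
    have hu := mem_verts_of_adj (h i he)
    have hv := mem_verts_of_adj (h i he).symm
    have hu' := mem_verts_of_adj (h j he')
    have hv' := mem_verts_of_adj (h j he').symm
    simp only [Function.Embedding.sym2Map_apply, Sym2.map_mk, Sym2.eq_iff] at hee
    rcases hee with ⟨h1, h2⟩ | ⟨h1, h2⟩
    · exact he.ne ((eq_corner_of_shift_eq hij hu hu' h1.symm).1.trans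
        (eq_corner_of_shift_eq hij hv hv' h2.symm).1.symm)
    · exact he.ne ((eq_corner_of_shift_eq hij hu hv' h2.symm).1.trans
        (eq_corner_of_shift_eq hij hv hu' h1.symm).1.symm)

theorem neighborSet_glue_of_unique {n : ℕ} {S : Fin 3 → SimpleGraph (ℕ × ℕ)}
    (h : ∀ i, S i ≤ bonds n) {i : Fin 3} {v : ℕ × ℕ}
    (hv : ∀ j, j ≠ i → ∀ q ∈ verts n, shift n j q ≠ shift n i v) :
    ((glue n S).neighborSet (shift n i v)).ncard = ((S i).neighborSet v).ncard := by
  rw [← Set.ncard_image_of_injective ((S i).neighborSet v) (shift n i).injective]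
  congr 1
  ext w
  simp only [SimpleGraph.mem_neighborSet, glue_adj, Set.mem_image]
  constructor
  · rintro ⟨j, u', v', hj, hu, rfl⟩
    by_cases hij : j = i
    · subst hij
      exact ⟨v', by rwa [(shift n j).injective hu] at hj, rfl⟩
    · exact absurd hu (hv j hij _ (mem_verts_of_adj (h j hj)))
  · rintro ⟨w', hw, rfl⟩
    exact ⟨i, v, w', hw, rfl, rfl⟩

theorem finite_neighborSet {n : ℕ} {S : SimpleGraph (ℕ × ℕ)} (h : S ≤ bonds n) (v : ℕ × ℕ) :
    (S.neighborSet v).Finite :=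
  (verts n).finite_toSet.subset fun _ hw => mem_verts_of_adj (h hw).symm

theorem neighborSet_glue_corner {n : ℕ} {S : Fin 3 → SimpleGraph (ℕ × ℕ)}
    (h : ∀ i, S i ≤ bonds n) (i : Fin 3) :
    ((glue n S).neighborSet (corner (n + 1) i)).ncard = ((S i).neighborSet (corner n i)).ncard := by
  rw [corner_succ]
  refine neighborSet_glue_of_unique h fun j hj q hq he => hj ?_
  exact corner_injective n (eq_corner_of_shift_eq hj hq (corner_mem n i) he).2.symm

theorem neighborSet_glue_mid {n : ℕ} {S : Fin 3 → SimpleGraph (ℕ × ℕ)}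
    (h : ∀ i, S i ≤ bonds n) {i j : Fin 3} (hij : i ≠ j) :
    ((glue n S).neighborSet (shift n i (corner n j))).ncard =
      ((S i).neighborSet (corner n j)).ncard + ((S j).neighborSet (corner n i)).ncard := by
  rw [← Set.ncard_image_of_injective ((S i).neighborSet _) (shift n i).injective,
    ← Set.ncard_image_of_injective ((S j).neighborSet _) (shift n j).injective,
    ← Set.ncard_union_eq ?_ ((finite_neighborSet (h i) _).image _)
      ((finite_neighborSet (h j) _).image _)]
  · congr 1
    ext w
    simp only [SimpleGraph.mem_neighborSet, glue_adj, Set.mem_image, Set.mem_union]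
    constructor
    · rintro ⟨k, u', v', hk, hu, rfl⟩
      by_cases hki : k = i
      · subst hki
        rw [(shift n k).injective hu] at hk
        exact Or.inl ⟨v', hk, rfl⟩
      · have hj := (eq_corner_of_shift_eq hki (mem_verts_of_adj (h k hk)) (corner_mem n j) hu)
        have hkj := corner_injective n hj.2
        subst hkj
        rw [hj.1] at hk
        exact Or.inr ⟨v', hk, rfl⟩
    · rintro (⟨w', hw, rfl⟩ | ⟨w', hw, rfl⟩)
      · exact ⟨i, _, w', hw, rfl, rfl⟩
      · exact ⟨j, _, w', hw, shift_corner_comm n j i, rfl⟩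
  · rw [Set.disjoint_left]
    rintro _ ⟨w, hw, rfl⟩ ⟨w', hw', hww⟩
    have := eq_corner_of_shift_eq hij (mem_verts_of_adj (h i hw).symm)
      (mem_verts_of_adj (h j hw').symm) hww.symm
    exact hw.ne this.1.symm

/-! ### Connectivity of glued subgraphs -/

/-- Every vertex of the stage-`n` gasket is joined to a corner by `S`. -/
def Rooted (n : ℕ) (S : SimpleGraph (ℕ × ℕ)) : Prop :=
  ∀ v ∈ verts n, ∃ i, S.Reachable (corner n i) v

/-- The corners of the stage-`n` gasket are partitioned by `τ` in `S`. -/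
def HasType (n : ℕ) (S : SimpleGraph (ℕ × ℕ)) (τ : Fin 5) : Prop :=
  ∀ x y, S.Reachable (corner n x) (corner n y) ↔ same τ x y = true

theorem exists_hasType (n : ℕ) (S : SimpleGraph (ℕ × ℕ)) : ∃ τ, HasType n S τ :=
  exists_same_iff _ ⟨fun _ => SimpleGraph.Reachable.refl _, fun h => h.symm, fun h h' => h.trans h'⟩

theorem HasType.unique {n : ℕ} {S : SimpleGraph (ℕ × ℕ)} {τ σ : Fin 5} (h : HasType n S τ)
    (h' : HasType n S σ) : τ = σ :=
  same_injective τ σ fun x y => Bool.eq_iff_iff.2 ((h x y).symm.trans (h' x y))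

theorem reachable_glue {n : ℕ} {S : Fin 3 → SimpleGraph (ℕ × ℕ)} {i : Fin 3} {u v : ℕ × ℕ}
    (h : (S i).Reachable u v) : (glue n S).Reachable (shift n i u) (shift n i v) := by
  refine h.map ⟨shift n i, fun {a b} hab => ?_⟩
  exact glue_adj.2 ⟨i, a, b, hab, rfl, rfl⟩

/-- A walk can change copies only at a meeting point, which is a corner of both. The stretch before
the change joins two corners of one copy and is therefore recorded by the type: it is one `Link`. -/
theorem reachable_glue_iff {n : ℕ} {S : Fin 3 → SimpleGraph (ℕ × ℕ)} (h : ∀ i, S i ≤ bonds n)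
    {t : Fin 3 → Fin 5} (ht : ∀ i, HasType n (S i) (t i)) {x : Fin 3} {v : ℕ × ℕ} :
    (glue n S).Reachable (corner (n + 1) x) v ↔
      ∃ i j v', Linked t (x, x) (i, j) ∧ (S i).Reachable (corner n j) v' ∧ shift n i v' = v := by
  constructor
  · intro hr
    rw [SimpleGraph.reachable_iff_reflTransGen] at hr
    induction hr with
    | refl =>
      exact ⟨x, x, corner n x, Relation.ReflTransGen.refl, SimpleGraph.Reachable.refl _,
        (corner_succ n x).symm⟩
    | @tail u w _ huw ih =>
      obtain ⟨i, k, v', hl, hk, rfl⟩ := ih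
      obtain ⟨j, u', w', hj, hu, rfl⟩ := glue_adj.1 huw
      by_cases hij : i = j
      · subst hij
        rw [(shift n i).injective hu] at hj
        exact ⟨i, k, w', hl, hk.trans hj.reachable, rfl⟩
      · have hv' := mem_verts_of_reachable (h i) (corner_mem n k) hk
        obtain ⟨rfl, rfl⟩ := eq_corner_of_shift_eq hij hv' (mem_verts_of_adj (h j hj)) hu.symm
        exact ⟨j, i, w', hl.tail ⟨(ht i k j).1 hk, rfl⟩, hj.reachable, rfl⟩
  · have hl : ∀ a, Linked t (x, x) a →
        (glue n S).Reachable (corner (n + 1) x) (shift n a.1 (corner n a.2)) := by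
      intro a ha
      induction ha with
      | refl => rw [corner_succ]
      | @tail a b _ hab ih =>
        refine ih.trans ?_
        have := reachable_glue (n := n) (S := S) ((ht a.1 a.2 b.1).2 hab.1)
        rwa [hab.2, shift_corner_comm n b.1 a.1]
    rintro ⟨i, j, v', hij, hr, rfl⟩
    exact (hl _ hij).trans (reachable_glue hr)

theorem reachable_glue_corner_iff {n : ℕ} {S : Fin 3 → SimpleGraph (ℕ × ℕ)}
    (h : ∀ i, S i ≤ bonds n) {t : Fin 3 → Fin 5} (ht : ∀ i, HasType n (S i) (t i))
    {x i j : Fin 3} :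
    (glue n S).Reachable (corner (n + 1) x) (shift n i (corner n j)) ↔ Linked t (x, x) (i, j) := by
  rw [reachable_glue_iff h ht]
  constructor
  · rintro ⟨k, l, v', hl, hr, he⟩
    by_cases hki : k = i
    · subst hki
      rw [(shift n k).injective he, ht] at hr
      exact hl.trans (linked_of_same hr)
    · obtain ⟨rfl, hj⟩ := eq_corner_of_shift_eq hki
        (mem_verts_of_reachable (h k) (corner_mem n l) hr) (corner_mem n j) he
      rw [corner_injective n hj]
      exact hl.tail ⟨(ht k l i).1 hr, rfl⟩
  · intro hl
    exact ⟨i, j, _, hl, SimpleGraph.Reachable.refl _, rfl⟩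

theorem hasType_glue_iff {n : ℕ} {S : Fin 3 → SimpleGraph (ℕ × ℕ)}
    (h : ∀ i, S i ≤ bonds n) {t : Fin 3 → Fin 5} (ht : ∀ i, HasType n (S i) (t i)) {τ : Fin 5} :
    HasType (n + 1) (glue n S) τ ↔ Glues t τ := by
  refine forall₂_congr fun x y => ?_
  rw [corner_succ n y, reachable_glue_corner_iff h ht]

/-- A path from an outer corner enters a copy through a corner of that copy, so each piece is rooted
too. -/
theorem rooted_glue_iff {n : ℕ} {S : Fin 3 → SimpleGraph (ℕ × ℕ)}
    (h : ∀ i, S i ≤ bonds n) {t : Fin 3 → Fin 5} (ht : ∀ i, HasType n (S i) (t i)) :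
    Rooted (n + 1) (glue n S) ↔ (∀ i, Rooted n (S i)) ∧ Covers t := by
  constructor
  · intro hr
    constructor
    · intro i v hv
      obtain ⟨x, hx⟩ := hr _ (mem_verts_succ.2 ⟨i, v, hv, rfl⟩)
      obtain ⟨k, l, v', -, hk, he⟩ := (reachable_glue_iff h ht).1 hx
      by_cases hki : k = i
      · subst hki
        rw [(shift n k).injective he] at hk
        exact ⟨l, hk⟩
      · exact ⟨k, by rw [(eq_corner_of_shift_eq hki
          (mem_verts_of_reachable (h k) (corner_mem n l) hk) hv he).2]⟩
    · rintro ⟨i, j⟩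
      obtain ⟨x, hx⟩ := hr _ (mem_verts_succ.2 ⟨i, _, corner_mem n j, rfl⟩)
      exact ⟨x, (reachable_glue_corner_iff h ht).1 hx⟩
  · rintro ⟨hr, hc⟩ v hv
    obtain ⟨i, v', hv', rfl⟩ := mem_verts_succ.1 hv
    obtain ⟨j, hj⟩ := hr i v' hv'
    obtain ⟨x, hx⟩ := hc (i, j)
    exact ⟨x, (reachable_glue_iff h ht).2 ⟨i, j, v', hx, hj, rfl⟩⟩

/-! ### Subgraphs of the triangle -/

theorem bonds_zero_adj {u v : ℕ × ℕ} :
    (bonds 0).Adj u v ↔ ∃ i j, i ≠ j ∧ corner 0 i = u ∧ corner 0 j = v := by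
  simp only [bonds, SimpleGraph.fromEdgeSet_adj, Set.mem_insert_iff, Set.mem_singleton_iff,
    Sym2.eq_iff]
  constructor
  · rintro ⟨(⟨rfl, rfl⟩ | ⟨rfl, rfl⟩) | (⟨rfl, rfl⟩ | ⟨rfl, rfl⟩) | (⟨rfl, rfl⟩ | ⟨rfl, rfl⟩), -⟩
    exacts [⟨0, 1, by decide, rfl, rfl⟩, ⟨1, 0, by decide, rfl, rfl⟩,
      ⟨0, 2, by decide, rfl, rfl⟩, ⟨2, 0, by decide, rfl, rfl⟩,
      ⟨1, 2, by decide, rfl, rfl⟩, ⟨2, 1, by decide, rfl, rfl⟩]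
  · rintro ⟨i, j, hij, rfl, rfl⟩
    revert i j
    decide

/-- The graph on three vertices that has the edge opposite to `i` if `e i` is true. -/
def triangle (e : Fin 3 → Bool) : SimpleGraph (Fin 3) where
  -- Since 0 + 1 + 2 = 0 in `Fin 3`, the third vertex is `-(i + j)`.
  Adj i j := i ≠ j ∧ e (-(i + j)) = true
  symm := ⟨fun i j h => ⟨h.1.symm, by rw [add_comm]; exact h.2⟩⟩
  loopless := ⟨fun _ h => h.1 rfl⟩

instance (e : Fin 3 → Bool) : DecidableRel (triangle e).Adj := fun i j =>
  inferInstanceAs (Decidable (i ≠ j ∧ e (-(i + j)) = true))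

/-- A subgraph of the stage-`0` gasket. -/
def triangleBonds (e : Fin 3 → Bool) : SimpleGraph (ℕ × ℕ) :=
  (triangle e).map (⟨corner 0, corner_injective 0⟩ : Fin 3 ↪ ℕ × ℕ)

theorem triangleBonds_adj {e : Fin 3 → Bool} {u v : ℕ × ℕ} :
    (triangleBonds e).Adj u v ↔
      ∃ i j, (i ≠ j ∧ e (-(i + j)) = true) ∧ corner 0 i = u ∧ corner 0 j = v := by
  rw [triangleBonds, SimpleGraph.map_adj]
  rfl

theorem triangleBonds_le (e : Fin 3 → Bool) : triangleBonds e ≤ bonds 0 := by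
  intro u v h
  obtain ⟨i, j, h, hu, hv⟩ := triangleBonds_adj.1 h
  exact bonds_zero_adj.2 ⟨i, j, h.1, hu, hv⟩

theorem triangle_injective : Function.Injective triangle := by
  intro e e' h
  funext k
  have : ∀ i j, (triangle e).Adj i j ↔ (triangle e').Adj i j := fun i j => by rw [h]
  have key : ∀ k : Fin 3, k + 1 ≠ k + 2 ∧ -((k + 1) + (k + 2)) = k := by decide
  have hk := this (k + 1) (k + 2)
  simp only [triangle, (key k).1, (key k).2, ne_eq, not_false_eq_true, true_and] at hk
  exact Bool.eq_iff_iff.2 hk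

theorem triangleBonds_injective : Function.Injective triangleBonds :=
  (SimpleGraph.map_injective _).comp triangle_injective

theorem exists_triangleBonds {S : SimpleGraph (ℕ × ℕ)} (h : S ≤ bonds 0) :
    ∃ e, triangleBonds e = S := by
  classical
  refine ⟨fun k => decide (S.Adj (corner 0 (k + 1)) (corner 0 (k + 2))), ?_⟩
  have key : ∀ i j : Fin 3, i ≠ j →
      (-(i + j) + 1 = i ∧ -(i + j) + 2 = j) ∨ (-(i + j) + 1 = j ∧ -(i + j) + 2 = i) := by decide
  ext u v
  rw [triangleBonds_adj]
  simp only [decide_eq_true_eq]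
  constructor
  · rintro ⟨i, j, ⟨hij, hs⟩, rfl, rfl⟩
    rcases key i j hij with h | h
    · rwa [h.1, h.2] at hs
    · rw [h.1, h.2] at hs
      exact hs.symm
  · intro huv
    obtain ⟨i, j, hij, rfl, rfl⟩ := bonds_zero_adj.1 (h huv)
    refine ⟨i, j, ⟨hij, ?_⟩, rfl, rfl⟩
    rcases key i j hij with h | h
    · rwa [h.1, h.2]
    · rw [h.1, h.2]
      exact huv.symm

/-- The partition of the corners of a subgraph of the triangle. -/
def triangleType (e : Fin 3 → Bool) : Fin 5 :=
  if e 0 && e 1 || e 0 && e 2 || e 1 && e 2 then 0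
  else if e 0 then 1 else if e 1 then 2 else if e 2 then 3 else 4

/-- The last alternative is the path through the third corner, made of the edges opposite to `x` and
to `y`. -/
theorem same_triangleType : ∀ (e : Fin 3 → Bool) (x y : Fin 3),
    same (triangleType e) x y = (x == y || e (-(x + y)) || (e x && e y)) := by decide

theorem same_trans : ∀ (τ : Fin 5) (x y z : Fin 3),
    same τ x y = true → same τ y z = true → same τ x z = true := by decide

theorem hasType_triangleBonds (e : Fin 3 → Bool) :
    HasType 0 (triangleBonds e) (triangleType e) := by
  have adj : ∀ x y, x ≠ y → e (-(x + y)) = true →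
      (triangleBonds e).Reachable (corner 0 x) (corner 0 y) := fun x y hxy h =>
    (triangleBonds_adj.2 ⟨x, y, ⟨hxy, h⟩, rfl, rfl⟩).reachable
  intro x y
  constructor
  · have : ∀ v, (triangleBonds e).Reachable (corner 0 x) v →
        ∃ z, corner 0 z = v ∧ same (triangleType e) x z = true := by
      intro v hv
      rw [SimpleGraph.reachable_iff_reflTransGen] at hv
      induction hv with
      | refl => exact ⟨x, rfl, same_refl _ _⟩
      | @tail u w _ huw ih =>
        obtain ⟨z, rfl, hz⟩ := ih
        obtain ⟨i, j, hij, hi, rfl⟩ := triangleBonds_adj.1 huw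
        rw [corner_injective 0 hi] at hij
        exact ⟨j, rfl, same_trans _ _ _ _ hz (by
          rw [same_triangleType, hij.2, Bool.or_true, Bool.true_or])⟩
    intro h
    obtain ⟨z, hz, hs⟩ := this _ h
    rwa [corner_injective 0 hz] at hs
  · intro h
    rw [same_triangleType, Bool.or_eq_true, Bool.or_eq_true, beq_iff_eq, Bool.and_eq_true] at h
    by_cases hxy : x = y
    · rw [hxy]
    · have key : ∀ x y : Fin 3, x ≠ y → x ≠ -(x + y) ∧ -(x + y) ≠ y ∧
          -(x + -(x + y)) = y ∧ -(-(x + y) + y) = x := by decide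
      obtain ⟨h1, h2, h3, h4⟩ := key x y hxy
      rcases h with (h | h) | h
      · exact absurd h hxy
      · exact adj x y hxy h
      · exact (adj x _ h1 (by rw [h3]; exact h.2)).trans (adj _ y h2 (by rw [h4]; exact h.1))

theorem ncard_edgeSet_triangleBonds (e : Fin 3 → Bool) :
    (triangleBonds e).edgeSet.ncard = ∑ i, (e i).toNat := by
  rw [triangleBonds, SimpleGraph.edgeSet_map,
    Set.ncard_image_of_injective _ (Function.Embedding.injective _), Set.ncard_eq_toFinset_card',
    ← SimpleGraph.edgeFinset]
  revert e
  decide +kernel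

theorem ncard_neighborSet_triangleBonds (e : Fin 3 → Bool) (i : Fin 3) :
    ((triangleBonds e).neighborSet (corner 0 i)).ncard = (e (i + 1)).toNat + (e (i + 2)).toNat := by
  have := SimpleGraph.neighborSet_map
    (⟨corner 0, corner_injective 0⟩ : Fin 3 ↪ ℕ × ℕ) (G := triangle e) i
  rw [triangleBonds]
  erw [this]
  rw [Set.ncard_image_of_injective _ (Function.Embedding.injective _),
    Set.ncard_eq_toFinset_card', ← SimpleGraph.neighborFinset]
  clear this
  revert e i
  decide +kernel

theorem rooted_zero (S : SimpleGraph (ℕ × ℕ)) : Rooted 0 S := by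
  intro v hv
  have : ∃ i, corner 0 i = v := by
    simp only [verts, Finset.mem_insert, Finset.mem_singleton] at hv
    rcases hv with rfl | rfl | rfl
    exacts [⟨0, rfl⟩, ⟨1, rfl⟩, ⟨2, rfl⟩]
  obtain ⟨i, rfl⟩ := this
  exact ⟨i, SimpleGraph.Reachable.refl _⟩

/-! ### Spanning forests rooted at the corners -/

/-- A rooted subgraph has at least as many edges as a forest. -/
theorem card_verts_le {n : ℕ} {S : SimpleGraph (ℕ × ℕ)} {τ : Fin 5} (h : S ≤ bonds n)
    (hr : Rooted n S) (hτ : HasType n S τ) : (verts n).card ≤ S.edgeSet.ncard + blocks τ := by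
  induction n generalizing S τ with
  | zero =>
    obtain ⟨e, rfl⟩ := exists_triangleBonds h
    rw [← (hasType_triangleBonds e).unique hτ, ncard_edgeSet_triangleBonds]
    revert e
    have : ∀ e : Fin 3 → Bool, (verts 0).card ≤ ∑ i, (e i).toNat + blocks (triangleType e) := by
      decide +kernel
    exact fun e _ _ _ => this e
  | succ n ih =>
    rw [← glue_piece h] at hr hτ ⊢
    choose t ht using fun i => exists_hasType n (piece n S i)
    have hp := piece_le n S
    rw [rooted_glue_iff hp ht] at hr
    rw [hasType_glue_iff hp ht] at hτ
    rw [ncard_edgeSet_glue hp]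
    have h1 := Finset.sum_le_sum fun i (_ : i ∈ Finset.univ) => ih (hp i) (hr.1 i) (ht i)
    have h2 := sum_blocks_le hr.2 hτ
    have h3 := card_verts_succ n
    rw [Finset.sum_add_distrib, Finset.sum_const, Finset.card_univ, Fintype.card_fin,
      smul_eq_mul] at h1
    omega

/-- `S` is a spanning forest of the stage-`n` gasket each of whose components contains a corner,
the corners being partitioned by `τ`. -/
def IsForest (n : ℕ) (τ : Fin 5) (S : SimpleGraph (ℕ × ℕ)) : Prop :=
  S ≤ bonds n ∧ Rooted n S ∧ HasType n S τ ∧ S.edgeSet.ncard + blocks τ = (verts n).card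

/-- For the forward direction, the lower bounds `card_verts_le` on the pieces and `sum_blocks_le`
add up to the lower bound for the whole. Equality there forces equality in each: the pieces are
forests and the gluing closes no cycle. -/
theorem isForest_glue_iff {n : ℕ} {S : Fin 3 → SimpleGraph (ℕ × ℕ)} (h : ∀ i, S i ≤ bonds n)
    {τ : Fin 5} : IsForest (n + 1) τ (glue n S) ↔ ∃ t ∈ good τ, ∀ i, IsForest n (t i) (S i) := by
  have h3 := card_verts_succ n
  constructor
  · rintro ⟨-, hr, hτ, hc⟩
    choose t ht using fun i => exists_hasType n (S i)
    rw [rooted_glue_iff h ht] at hr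
    rw [hasType_glue_iff h ht] at hτ
    rw [ncard_edgeSet_glue h] at hc
    have h1 := fun i => card_verts_le (h i) (hr.1 i) (ht i)
    have h2 := sum_blocks_le hr.2 hτ
    simp only [Fin.sum_univ_three] at hc h2
    have h10 := h1 0
    have h11 := h1 1
    have h12 := h1 2
    refine ⟨t, mem_good.2 ⟨hr.2, hτ, ?_⟩, fun i => ⟨h i, hr.1 i, ht i, ?_⟩⟩
    · rw [Fin.sum_univ_three]
      omega
    · have hs : ∀ i, (S i).edgeSet.ncard + blocks (t i) = (verts n).card := by
        simp only [Fin.forall_fin_succ]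
        refine ⟨?_, ?_, ?_, nofun⟩
        · exact (by omega : (S 0).edgeSet.ncard + blocks (t 0) = (verts n).card)
        · exact (by omega : (S 1).edgeSet.ncard + blocks (t 1) = (verts n).card)
        · exact (by omega : (S 2).edgeSet.ncard + blocks (t 2) = (verts n).card)
      exact hs i
  · rintro ⟨t, htg, ht⟩
    obtain ⟨hc, hg, hb⟩ := mem_good.1 htg
    have ht' := fun i => (ht i).2.2.1
    refine ⟨glue_le h, (rooted_glue_iff h ht').2 ⟨fun i => (ht i).2.1, hc⟩,
      (hasType_glue_iff h ht').2 hg, ?_⟩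
    rw [ncard_edgeSet_glue h]
    have h10 := (ht 0).2.2.2
    have h11 := (ht 1).2.2.2
    have h12 := (ht 2).2.2.2
    rw [Fin.sum_univ_three] at hb ⊢
    omega

/-- The finite set of the forests of type `τ`. -/
noncomputable def forests (n : ℕ) (τ : Fin 5) : Finset (SimpleGraph (ℕ × ℕ)) :=
  ((finite_Iic_bonds n).subset fun _ h => h.1 : {S | IsForest n τ S}.Finite).toFinset

theorem mem_forests {n : ℕ} {τ : Fin 5} {S : SimpleGraph (ℕ × ℕ)} :
    S ∈ forests n τ ↔ IsForest n τ S := by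
  simp [forests]

-- A forest determines its pieces, and the pieces determine their types, so the triples in `good τ`
-- index a disjoint decomposition.
set_option linter.constructorNameAsVariable false in
theorem sum_forests_succ {M : Type*} [AddCommMonoid M] (n : ℕ) (τ : Fin 5)
    (Φ : SimpleGraph (ℕ × ℕ) → M) :
    ∑ G ∈ forests (n + 1) τ, Φ G =
      ∑ t ∈ good τ, ∑ S ∈ Fintype.piFinset fun i => forests n (t i), Φ (glue n S) := by
  rw [Finset.sum_sigma']
  symm
  refine Finset.sum_bij (fun x _ => glue n x.2) ?_ ?_ ?_ (fun _ _ => rfl)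
  · rintro ⟨t, S⟩ h
    simp only [Finset.mem_sigma, Fintype.mem_piFinset, mem_forests] at h ⊢
    exact (isForest_glue_iff fun i => (h.2 i).1).2 ⟨t, h.1, h.2⟩
  · rintro ⟨t, S⟩ h ⟨t', S'⟩ h' he
    simp only [Finset.mem_sigma, Fintype.mem_piFinset, mem_forests] at h h' he
    have hS : S = S' := by
      rw [← piece_glue fun i => (h.2 i).1, he, piece_glue fun i => (h'.2 i).1]
    subst hS
    have ht : t = t' := funext fun i => (h.2 i).2.2.1.unique (h'.2 i).2.2.1
    subst ht
    rfl
  · intro G hG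
    rw [mem_forests] at hG
    have hp := piece_le n G
    have hle := hG.1
    rw [← glue_piece hle, isForest_glue_iff hp] at hG
    obtain ⟨t, htg, ht⟩ := hG
    refine ⟨⟨t, piece n G⟩, ?_, glue_piece hle⟩
    simp only [Finset.mem_sigma, Fintype.mem_piFinset, mem_forests]
    exact ⟨htg, ht⟩

/-- A statistic that is multiplicative under gluing. -/
theorem sum_forests_succ_of_prod {R : Type*} [CommSemiring R] {n : ℕ} (τ : Fin 5)
    {Φ : SimpleGraph (ℕ × ℕ) → R} {φ : Fin 3 → SimpleGraph (ℕ × ℕ) → R}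
    (h : ∀ S : Fin 3 → SimpleGraph (ℕ × ℕ), (∀ i, S i ≤ bonds n) → Φ (glue n S) = ∏ i, φ i (S i)) :
    ∑ G ∈ forests (n + 1) τ, Φ G = ∑ t ∈ good τ, ∏ i, ∑ S ∈ forests n (t i), φ i S := by
  rw [sum_forests_succ]
  refine Finset.sum_congr rfl fun t _ => ?_
  rw [Finset.prod_univ_sum]
  refine Finset.sum_congr rfl fun S hS => h S fun i => ?_
  exact (mem_forests.1 (Fintype.mem_piFinset.1 hS i)).1

theorem sum_forests_zero {M : Type*} [AddCommMonoid M] (τ : Fin 5)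
    (Φ : SimpleGraph (ℕ × ℕ) → M) :
    ∑ S ∈ forests 0 τ, Φ S =
      ∑ e : Fin 3 → Bool with triangleType e = τ ∧ ∑ i, (e i).toNat + blocks τ = 3,
        Φ (triangleBonds e) := by
  symm
  refine Finset.sum_bij (fun e _ => triangleBonds e) ?_ ?_ ?_ (fun _ _ => rfl)
  · intro e he
    rw [Finset.mem_filter] at he
    refine mem_forests.2 ⟨triangleBonds_le e, rooted_zero _, ?_, ?_⟩
    · rw [← he.2.1]
      exact hasType_triangleBonds e
    · rw [ncard_edgeSet_triangleBonds, he.2.2]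
      rfl
  · exact fun e _ e' _ h => triangleBonds_injective h
  · intro S hS
    obtain ⟨hb, -, hτ, hc⟩ := mem_forests.1 hS
    obtain ⟨e, rfl⟩ := exists_triangleBonds hb
    rw [ncard_edgeSet_triangleBonds] at hc
    exact ⟨e, Finset.mem_filter.2 ⟨Finset.mem_univ _, (hasType_triangleBonds e).unique hτ, hc⟩, rfl⟩

/-! ### Counting forests -/

/-- The number of forests of type `τ`. -/
noncomputable def numForests (n : ℕ) (τ : Fin 5) : ℝ := ∑ _S ∈ forests n τ, 1

/-- The indicator of the subgraphs in which `x` has degree `j`. -/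
noncomputable def hasDegree (x : ℕ × ℕ) (j : ℕ) (S : SimpleGraph (ℕ × ℕ)) : ℝ :=
  if (S.neighborSet x).ncard = j then 1 else 0

/-- The number of forests of type `τ` in which `x` has degree `j`. -/
noncomputable def numForestsDeg (n : ℕ) (x : ℕ × ℕ) (j : ℕ) (τ : Fin 5) : ℝ :=
  ∑ S ∈ forests n τ, hasDegree x j S

/-- The proportion of the forests of type `τ` in which `x` has degree `j`. -/
noncomputable def forestProb (n : ℕ) (x : ℕ × ℕ) (j : ℕ) (τ : Fin 5) : ℝ :=
  numForestsDeg n x j τ / numForests n τ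

theorem numForests_succ (n : ℕ) (τ : Fin 5) :
    numForests (n + 1) τ = ∑ t ∈ good τ, ∏ i, numForests n (t i) :=
  sum_forests_succ_of_prod τ (φ := fun _ _ => 1) (by simp)

theorem numForestsDeg_succ {n : ℕ} {i : Fin 3} {x y : ℕ × ℕ} (j : ℕ) (τ : Fin 5)
    (h : ∀ S : Fin 3 → SimpleGraph (ℕ × ℕ), (∀ i, S i ≤ bonds n) →
      ((glue n S).neighborSet y).ncard = ((S i).neighborSet x).ncard) :
    numForestsDeg (n + 1) y j τ = ∑ t ∈ good τ, ∏ k,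
      if k = i then numForestsDeg n x j (t k) else numForests n (t k) := by
  rw [numForestsDeg, sum_forests_succ_of_prod τ
    (φ := fun k => if k = i then hasDegree x j else fun _ => 1)]
  · refine Finset.sum_congr rfl fun t _ => Finset.prod_congr rfl fun k _ => ?_
    split_ifs <;> rfl
  · intro S hS
    rw [Finset.prod_eq_single i]
    · simp [hasDegree, h S hS]
    · intro k _ hk
      simp [hk]
    · simp

theorem numForestsDeg_mid {n : ℕ} {i k : Fin 3} (hik : i ≠ k) (j : ℕ) (τ : Fin 5) :
    numForestsDeg (n + 1) (shift n i (corner n k)) j τ =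
      ∑ p ∈ Finset.HasAntidiagonal.antidiagonal j, ∑ t ∈ good τ, ∏ l,
        if l = i then numForestsDeg n (corner n k) p.1 (t l)
        else if l = k then numForestsDeg n (corner n i) p.2 (t l) else numForests n (t l) := by
  -- The degree is additive over the two copies. Splitting its value over the antidiagonal gives
  -- terms that are multiplicative under gluing.
  have hd : ∀ S ∈ forests (n + 1) τ, hasDegree (shift n i (corner n k)) j S =
      ∑ p ∈ Finset.HasAntidiagonal.antidiagonal j, hasDegree (corner n k) p.1 (piece n S i) *
        hasDegree (corner n i) p.2 (piece n S k) := by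
    intro S hS
    rw [hasDegree]
    conv_lhs => rw [← glue_piece (mem_forests.1 hS).1, neighborSet_glue_mid (piece_le n S) hik]
    simp only [hasDegree, ← ite_and, mul_ite, mul_one, mul_zero]
    set a := ((piece n S i).neighborSet (corner n k)).ncard
    set b := ((piece n S k).neighborSet (corner n i)).ncard
    split_ifs with hab
    · rw [Finset.sum_eq_single (a, b)]
      · simp
      · rintro ⟨c, d⟩ _ hcd
        rw [if_neg]
        rintro ⟨rfl, rfl⟩
        exact hcd rfl
      · intro hn
        exact absurd (Finset.HasAntidiagonal.mem_antidiagonal.2 hab) hn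
    · symm
      refine Finset.sum_eq_zero fun p hp => if_neg ?_
      rintro ⟨h1, h2⟩
      rw [h1, h2] at hab
      exact hab (Finset.HasAntidiagonal.mem_antidiagonal.1 hp)
  rw [numForestsDeg, Finset.sum_congr rfl hd, Finset.sum_comm]
  refine Finset.sum_congr rfl fun p _ => ?_
  rw [sum_forests_succ_of_prod τ (φ := fun l => if l = i then hasDegree (corner n k) p.1
    else if l = k then hasDegree (corner n i) p.2 else fun _ => 1)]
  · refine Finset.sum_congr rfl fun t _ => Finset.prod_congr rfl fun l _ => ?_
    split_ifs <;> rfl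
  · intro S hS
    rw [piece_glue hS, ← Finset.prod_subset (Finset.subset_univ {i, k}),
      Finset.prod_pair hik]
    · simp [hik.symm]
    · intro l _ hl
      simp only [Finset.mem_insert, Finset.mem_singleton, not_or] at hl
      simp [hl.1, hl.2]

theorem numForests_zero (τ : Fin 5) : numForests 0 τ = if τ = 0 then 3 else 1 := by
  rw [numForests, sum_forests_zero, Finset.sum_const, nsmul_eq_mul, mul_one]
  have : ∀ τ : Fin 5, (Finset.univ.filter fun e : Fin 3 → Bool =>
      triangleType e = τ ∧ ∑ i, (e i).toNat + blocks τ = 3).card = if τ = 0 then 3 else 1 := by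
    decide +kernel
  rw [this]
  push_cast
  rfl

/-- The numerical coincidence behind self-similarity: 6, 10, 50 are geometric with ratio 5/3 once
divided by the weights 1, 1, 3. -/
theorem total_eq (τ : Fin 5) :
    (total τ : ℝ) = 18 / 5 * (5 / 3) ^ blocks τ * weight τ := by
  fin_cases τ <;> norm_num [total, blocks, weight, Fin.ext_iff]

/-- Up to the factors `weight τ`, the number of forests is geometric in the number of blocks. -/
theorem exists_numForests_eq (n : ℕ) :
    ∃ F r : ℝ, 0 < F ∧ 0 < r ∧ ∀ τ, numForests n τ = F * r ^ blocks τ * weight τ := by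
  induction n with
  | zero =>
    -- Solves `F * r = 3`, `F * r ^ 2 = 1`, `3 * F * r ^ 3 = 1`, the counts on the triangle.
    refine ⟨9, 1 / 3, by norm_num, by norm_num, fun τ => ?_⟩
    rw [numForests_zero]
    fin_cases τ <;> norm_num [blocks, weight, Fin.ext_iff]
  | succ n ih =>
    obtain ⟨F, r, hF, hr, h⟩ := ih
    refine ⟨18 / 5 * (F * r) ^ 3, 5 / 3 * r, by positivity, by positivity, fun τ => ?_⟩
    have hs : ∀ t ∈ good τ, ∏ i, numForests n (t i) =
        F ^ 3 * r ^ (blocks τ + 3) * ((∏ k, weight (t k) : ℕ) : ℝ) := by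
      intro t ht
      simp only [h, Finset.prod_mul_distrib, Finset.prod_const, Finset.prod_pow_eq_pow_sum,
        (mem_good.1 ht).2.2, Finset.card_univ, Fintype.card_fin, Nat.cast_prod]
    rw [numForests_succ, Finset.sum_congr rfl hs, ← Finset.mul_sum, ← Nat.cast_sum,
      sum_weight_good, total_eq]
    ring

theorem numForests_pos (n : ℕ) (τ : Fin 5) : 0 < numForests n τ := by
  obtain ⟨F, r, hF, hr, h⟩ := exists_numForests_eq n
  rw [h]
  have : 0 < weight τ := by unfold weight; split_ifs <;> norm_num
  positivity

theorem total_pos (τ : Fin 5) : (0 : ℝ) < total τ := by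
  unfold total; split_ifs <;> norm_num

/-- The types of the three copies in a random forest of type `τ` have a distribution that does not
depend on the stage. -/
theorem prod_numForests {n : ℕ} {τ : Fin 5} {t : Fin 3 → Fin 5} (ht : t ∈ good τ) :
    (∏ i, numForests n (t i)) / numForests (n + 1) τ =
      ((∏ k, weight (t k) : ℕ) : ℝ) / total τ := by
  obtain ⟨F, r, hF, hr, h⟩ := exists_numForests_eq n
  have hs : ∀ t ∈ good τ, ∏ i, numForests n (t i) =
      F ^ 3 * r ^ (blocks τ + 3) * ((∏ k, weight (t k) : ℕ) : ℝ) := by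
    intro t ht
    simp only [h, Finset.prod_mul_distrib, Finset.prod_const, Finset.prod_pow_eq_pow_sum,
      (mem_good.1 ht).2.2, Finset.card_univ, Fintype.card_fin, Nat.cast_prod]
  rw [numForests_succ, Finset.sum_congr rfl hs, ← Finset.mul_sum, ← Nat.cast_sum,
    sum_weight_good, hs t ht]
  have := total_pos τ
  field_simp

theorem numForestsDeg_eq (n : ℕ) (x : ℕ × ℕ) (j : ℕ) (τ : Fin 5) :
    numForestsDeg n x j τ = forestProb n x j τ * numForests n τ :=
  (div_mul_cancel₀ _ (numForests_pos n τ).ne').symm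

/-- Conditioning on the type of copy `i`: one step of a Markov chain whose transition probabilities
do not involve `n`. -/
theorem forestProb_succ {n : ℕ} {i : Fin 3} {x y : ℕ × ℕ} (j : ℕ) (τ : Fin 5)
    (h : ∀ S : Fin 3 → SimpleGraph (ℕ × ℕ), (∀ i, S i ≤ bonds n) →
      ((glue n S).neighborSet y).ncard = ((S i).neighborSet x).ncard) :
    forestProb (n + 1) y j τ = ∑ σ, (transfer i τ σ : ℝ) / total τ * forestProb n x j σ := by
  have h1 : ∀ t ∈ good τ, (∏ k, if k = i then numForestsDeg n x j (t k) else numForests n (t k)) /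
      numForests (n + 1) τ =
      ((∏ k, weight (t k) : ℕ) : ℝ) / total τ * forestProb n x j (t i) := by
    intro t ht
    rw [← prod_numForests (n := n) ht, ← Finset.mul_prod_erase _ _ (Finset.mem_univ i),
      ← Finset.mul_prod_erase _ (fun k => numForests n (t k)) (Finset.mem_univ i), if_pos rfl,
      numForestsDeg_eq, Finset.prod_congr rfl fun k hk => if_neg (Finset.ne_of_mem_erase hk)]
    ring
  rw [forestProb, numForestsDeg_succ j τ h, Finset.sum_div, Finset.sum_congr rfl h1]
  simp only [transfer, Nat.cast_sum, Finset.sum_div, Finset.sum_mul]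
  rw [Finset.sum_comm]
  refine Finset.sum_congr rfl fun t _ => ?_
  rw [Finset.sum_eq_single (t i)]
  · simp
  · intro σ _ hσ
    simp [hσ.symm]
  · simp

/-- Given the types, the three pieces are chosen independently, hence the product of the two corner
probabilities. -/
theorem forestProb_mid {n : ℕ} {i k : Fin 3} (hik : i ≠ k) (j : ℕ) (τ : Fin 5) :
    forestProb (n + 1) (shift n i (corner n k)) j τ =
      ∑ p ∈ Finset.HasAntidiagonal.antidiagonal j, ∑ t ∈ good τ, ((∏ k, weight (t k) : ℕ) : ℝ) / total τ *
        (forestProb n (corner n k) p.1 (t i) * forestProb n (corner n i) p.2 (t k)) := by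
  rw [forestProb, numForestsDeg_mid hik, Finset.sum_div]
  refine Finset.sum_congr rfl fun p _ => ?_
  rw [Finset.sum_div]
  refine Finset.sum_congr rfl fun t ht => ?_
  have hk : k ∈ Finset.univ.erase i := Finset.mem_erase.2 ⟨hik.symm, Finset.mem_univ k⟩
  rw [← prod_numForests (n := n) ht, ← Finset.mul_prod_erase _ _ (Finset.mem_univ i),
    ← Finset.mul_prod_erase _ (fun k => numForests n (t k)) (Finset.mem_univ i),
    ← Finset.mul_prod_erase _ _ hk, ← Finset.mul_prod_erase _ (fun k => numForests n (t k)) hk,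
    if_pos rfl, if_neg hik.symm, if_pos rfl, numForestsDeg_eq, numForestsDeg_eq,
    Finset.prod_congr rfl fun l hl => (if_neg (Finset.ne_of_mem_erase
      (Finset.mem_of_mem_erase hl))).trans (if_neg (Finset.ne_of_mem_erase hl))]
  ring

theorem sum_transfer (i : Fin 3) (τ : Fin 5) : ∑ σ, (transfer i τ σ : ℝ) / total τ = 1 := by
  rw [← Finset.sum_div, div_eq_one_iff_eq (total_pos τ).ne']
  have : ∀ i τ, ∑ σ, transferTable i τ σ = total τ := by decide
  simp only [transfer_eq]
  exact_mod_cast this i τ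

theorem sum_weight_div (τ : Fin 5) :
    ∑ t ∈ good τ, ((∏ k, weight (t k) : ℕ) : ℝ) / total τ = 1 := by
  rw [← Finset.sum_div, div_eq_one_iff_eq (total_pos τ).ne', ← Nat.cast_sum, sum_weight_good]

/-! ### Degrees of the corners -/

/-- A linear recursion with four states, of which the last two are transient, forgets in which
state it started. -/
theorem tendsto_of_recursion {p q e k : ℕ → ℝ} {L : ℝ}
    (hp : ∀ n, p (n + 1) = 2 / 3 * p n + 1 / 3 * q n)
    (hq : ∀ n, q (n + 1) = 3 / 5 * p n + 2 / 5 * q n)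
    (he : ∀ n, e (n + 1) = 1 / 10 * p n + 1 / 5 * q n + 2 / 5 * e n + 3 / 10 * k n)
    (hk : ∀ n, k (n + 1) = 6 / 25 * p n + 7 / 25 * q n + 6 / 25 * e n + 6 / 25 * k n)
    (hL : 9 * p 0 + 5 * q 0 = 14 * L) :
    Tendsto p atTop (𝓝 L) ∧ Tendsto q atTop (𝓝 L) ∧ Tendsto e atTop (𝓝 L) ∧
      Tendsto k atTop (𝓝 L) := by
  -- (9, 5) is a left fixed vector of the closed block formed by `p` and `q`.
  have hinv : ∀ n, 9 * p n + 5 * q n = 14 * L := by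
    intro n
    induction n with
    | zero => exact hL
    | succ n ih => rw [hp, hq]; linarith
  obtain ⟨C, hC⟩ : ∃ C, |p 0 - L| + |q 0 - L| + |e 0 - L| + |k 0 - L| ≤ C := ⟨_, le_rfl⟩
  -- The invariant gives `q n - L = -(9 / 5) * (p n - L)`, so both contract by 1/15. The factor 4
  -- lets `e` and `k` absorb these terms at the cruder rate 9/10.
  have hb : ∀ n, |p n - L| ≤ C * (9 / 10) ^ n ∧ |q n - L| ≤ 9 / 5 * C * (9 / 10) ^ n ∧
      |e n - L| ≤ 4 * C * (9 / 10) ^ n ∧ |k n - L| ≤ 4 * C * (9 / 10) ^ n := by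
    intro n
    induction n with
    | zero =>
      have h1 := abs_nonneg (p 0 - L)
      have h2 := abs_nonneg (q 0 - L)
      have h3 := abs_nonneg (e 0 - L)
      have h4 := abs_nonneg (k 0 - L)
      simp only [pow_zero, mul_one]
      refine ⟨?_, ?_, ?_, ?_⟩ <;> linarith
    | succ n ih =>
      have h := hinv n
      obtain ⟨h1, h2, h3, h4⟩ := ih
      rw [pow_succ]
      set c := C * (9 / 10) ^ n
      rw [mul_assoc] at h2 h3 h4
      rw [abs_le] at h1 h2 h3 h4
      rw [mul_assoc (9 / 5), mul_assoc 4, ← mul_assoc C, hp, hq, he, hk]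
      simp only [abs_le]
      refine ⟨⟨?_, ?_⟩, ⟨?_, ?_⟩, ⟨?_, ?_⟩, ⟨?_, ?_⟩⟩ <;> linarith
  have lim : ∀ (u : ℕ → ℝ) (B : ℝ), (∀ n, |u n - L| ≤ B * (9 / 10) ^ n) →
      Tendsto u atTop (𝓝 L) := by
    intro u B hu
    rw [tendsto_iff_norm_sub_tendsto_zero]
    refine squeeze_zero (fun n => norm_nonneg _) hu ?_
    simpa using (tendsto_pow_atTop_nhds_zero_of_lt_one (r := (9 / 10 : ℝ)) (by norm_num)
      (by norm_num)).const_mul B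
  exact ⟨lim p _ fun n => (hb n).1, lim q _ fun n => (hb n).2.1, lim e _ fun n => (hb n).2.2.1,
    lim k _ fun n => (hb n).2.2.2⟩

theorem forestProb_corner_succ (n : ℕ) (i : Fin 3) (j : ℕ) (τ : Fin 5) :
    forestProb (n + 1) (corner (n + 1) i) j τ =
      ∑ σ, (transferTable i τ σ : ℝ) / total τ * forestProb n (corner n i) j σ := by
  rw [forestProb_succ j τ fun S hS => neighborSet_glue_corner hS i]
  simp only [transfer_eq]

theorem numForestsDeg_zero (i : Fin 3) (j : ℕ) (τ : Fin 5) :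
    numForestsDeg 0 (corner 0 i) j τ =
      ((Finset.univ.filter fun e : Fin 3 → Bool =>
        (triangleType e = τ ∧ ∑ i, (e i).toNat + blocks τ = 3) ∧
          (e (i + 1)).toNat + (e (i + 2)).toNat = j).card : ℝ) := by
  rw [numForestsDeg, sum_forests_zero]
  simp only [hasDegree, ncard_neighborSet_triangleBonds]
  rw [Finset.sum_boole, Finset.filter_filter]

/-- The limit distribution of the degree of a corner. -/
noncomputable def cornerLimit (j : ℕ) : ℝ := if j = 1 then 11 / 14 else if j = 2 then 3 / 14 else 0

/-- Only the types joining `i` to another corner are needed: the starting values of the transient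
types do not affect the limit. -/
theorem forestProb_zero (i : Fin 3) (j : ℕ) (τ : Fin 5) (h : τ ≠ 4) (hi : τ.val ≠ i.val + 1) :
    forestProb 0 (corner 0 i) j τ =
      if τ = 0 then (if j = 1 then 2 / 3 else if j = 2 then 1 / 3 else 0)
      else if j = 1 then 1 else 0 := by
  have key : ∀ (i : Fin 3) (τ : Fin 5), τ ≠ 4 → τ.val ≠ i.val + 1 → ∀ j : Fin 3,
      (Finset.univ.filter fun e : Fin 3 → Bool =>
        (triangleType e = τ ∧ ∑ i, (e i).toNat + blocks τ = 3) ∧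
          (e (i + 1)).toNat + (e (i + 2)).toNat = j.val).card =
      if τ = 0 then (if j.val = 1 then 2 else if j.val = 2 then 1 else 0)
      else if j.val = 1 then 1 else 0 := by
    decide +kernel
  rw [forestProb, numForestsDeg_zero, numForests_zero]
  by_cases hj : j < 3
  · rw [key i τ h hi ⟨j, hj⟩]
    split_ifs <;> norm_num
  · rw [Finset.filter_false_of_mem]
    · rw [if_neg (by omega : j ≠ 1), if_neg (by omega : j ≠ 2), if_neg (by omega : j ≠ 1)]
      simp
    · rintro e - ⟨-, he⟩
      have h1 := Bool.toNat_le (e (i + 1))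
      have h2 := Bool.toNat_le (e (i + 2))
      omega

theorem tendsto_forestProb_corner (i : Fin 3) (j : ℕ) (τ : Fin 5) :
    Tendsto (fun n => forestProb n (corner n i) j τ) atTop (𝓝 (cornerLimit j)) := by
  -- `σ` and `σ'` join `i` to one other corner, `ρ` separates it from the two others
  obtain ⟨σ, σ', ρ, hσ, hσ', hsep, hlist, htable⟩ : ∃ σ σ' ρ : Fin 5,
      (σ ≠ 0 ∧ σ ≠ 4 ∧ σ.val ≠ i.val + 1) ∧ (σ' ≠ 0 ∧ σ' ≠ 4 ∧ σ'.val ≠ i.val + 1) ∧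
      (ρ ≠ 0 ∧ ρ ≠ 4) ∧ (Finset.univ.val = {0, σ, σ', ρ, 4}) ∧
      [0, σ, σ', ρ, 4].map (fun τ => [0, σ, σ', ρ, 4].map (transferTable i τ)) =
        [[4, 1, 1, 0, 0], [6, 3, 1, 0, 0], [6, 1, 3, 0, 0], [1, 1, 1, 4, 3],
          [12, 7, 7, 12, 12]] := by
    revert i
    decide +kernel
  simp only [List.map_cons, List.map_nil, List.cons.injEq, and_true] at htable
  obtain ⟨⟨h00, h01, h02, h03, h04⟩, ⟨h10, h11, h12, h13, h14⟩, ⟨h20, h21, h22, h23, h24⟩,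
    ⟨h30, h31, h32, h33, h34⟩, h40, h41, h42, h43, h44⟩ := htable
  have hsum : ∀ f : Fin 5 → ℝ, ∑ x, f x = f 0 + (f σ + (f σ' + (f ρ + f 4))) := by
    intro f
    rw [Finset.sum, hlist]
    simp
  have hmem : τ ∈ (Finset.univ : Finset (Fin 5)).val := Finset.mem_univ τ
  rw [hlist] at hmem
  have hrec := fun n τ => forestProb_corner_succ n i j τ
  simp only [hsum] at hrec
  have t0 : (total 0 : ℝ) = 6 := by norm_num [total]
  have t4 : (total 4 : ℝ) = 50 := by norm_num [show total 4 = 50 from rfl]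
  have t1 : (total σ : ℝ) = 10 := by norm_num [total, hσ]
  have t2 : (total σ' : ℝ) = 10 := by norm_num [total, hσ']
  have t3 : (total ρ : ℝ) = 10 := by norm_num [total, hsep]
  have r0 := fun n => hrec n 0
  have r1 := fun n => hrec n σ
  have r2 := fun n => hrec n σ'
  have r3 := fun n => hrec n ρ
  have r4 := fun n => hrec n 4
  simp only [h00, h01, h02, h03, h04, t0] at r0
  simp only [h10, h11, h12, h13, h14, t1] at r1
  simp only [h20, h21, h22, h23, h24, t2] at r2
  simp only [h30, h31, h32, h33, h34, t3] at r3
  simp only [h40, h41, h42, h43, h44, t4] at r4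
  push_cast at r0 r1 r2 r3 r4
  have z0 := forestProb_zero i j 0 (by decide) (by simp)
  have z1 := forestProb_zero i j σ hσ.2.1 hσ.2.2
  have z2 := forestProb_zero i j σ' hσ'.2.1 hσ'.2.2
  rw [if_pos rfl] at z0
  rw [if_neg hσ.1] at z1
  rw [if_neg hσ'.1] at z2
  -- Exchanging the two other corners is a symmetry of the recursion and of its initial values. It
  -- reduces five states to four.
  have hq : ∀ n, forestProb n (corner n i) j σ' = forestProb n (corner n i) j σ := by
    intro n
    induction n with
    | zero => rw [z1, z2]
    | succ n ih => rw [r1, r2, ih]; ring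
  simp only [hq] at r0 r1 r3 r4
  obtain ⟨l0, l1, l3, l4⟩ := tendsto_of_recursion (L := cornerLimit j)
    (p := fun n => forestProb n (corner n i) j 0) (q := fun n => forestProb n (corner n i) j σ)
    (e := fun n => forestProb n (corner n i) j ρ) (k := fun n => forestProb n (corner n i) j 4)
    (fun n => by rw [r0]; ring) (fun n => by rw [r1]; ring) (fun n => by rw [r3]; ring)
    (fun n => by rw [r4]; ring) (by
      simp only [z0, z1, cornerLimit]
      by_cases h1 : j = 1
      · norm_num [h1]
      · by_cases h2 : j = 2 <;> norm_num [h1, h2])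
  simp only [Multiset.insert_eq_cons, Multiset.mem_cons, Multiset.mem_singleton] at hmem
  rcases hmem with rfl | rfl | rfl | rfl | rfl
  · exact l0
  · exact l1
  · simpa only [hq] using l1
  · exact l3
  · exact l4

/-! ### Degrees of the points where two copies meet -/

/-- The limit distribution of the degree of a point where two copies meet. -/
noncomputable def midLimit (j : ℕ) : ℝ :=
  ∑ p ∈ Finset.HasAntidiagonal.antidiagonal j, cornerLimit p.1 * cornerLimit p.2

/-- The corner limits are the same for every `t`, so the average over `good τ` has total mass one
and drops out. -/
theorem tendsto_forestProb_mid {i k : Fin 3} (hik : i ≠ k) (j : ℕ) (τ : Fin 5) :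
    Tendsto (fun n => forestProb (n + 1) (shift n i (corner n k)) j τ) atTop (𝓝 (midLimit j)) := by
  simp only [forestProb_mid hik]
  refine tendsto_finsetSum _ fun p _ => ?_
  have h := tendsto_finsetSum (good τ) fun t _ =>
    ((tendsto_forestProb_corner k p.1 (t i)).mul (tendsto_forestProb_corner i p.2 (t k))).const_mul
      (((∏ k, weight (t k) : ℕ) : ℝ) / total τ)
  rwa [← Finset.sum_mul, sum_weight_div, one_mul] at h

/-- Both coordinates of the meeting point are at most `2 ^ n`, whereas a copy with `l ≠ 0` has a
coordinate of at least `2 ^ N`. Hence at later stages the point lies in copy `0` only, and its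
degree is decided there. -/
theorem shift_ne_mid {n N : ℕ} (h : n < N) {i k l : Fin 3} (hik : i ≠ k) (hl : l ≠ 0)
    (q : ℕ × ℕ) : shift N l q ≠ shift n i (corner n k) := by
  have hlt : 2 ^ n < 2 ^ N := Nat.pow_lt_pow_right (by norm_num) h
  obtain ⟨a, b⟩ := q
  fin_cases l <;> fin_cases i <;> fin_cases k <;> simp [shift_apply, corner] at hik hl ⊢ <;> omega

theorem tendsto_forestProb_mid_add {i k : Fin 3} (hik : i ≠ k) (j m : ℕ) (τ : Fin 5) :
    Tendsto (fun n => forestProb (n + m + 1) (shift n i (corner n k)) j τ) atTop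
      (𝓝 (midLimit j)) := by
  induction m generalizing τ with
  | zero => exact tendsto_forestProb_mid hik j τ
  | succ m ih =>
    have hrec : ∀ n, forestProb (n + (m + 1) + 1) (shift n i (corner n k)) j τ =
        ∑ σ, (transfer 0 τ σ : ℝ) / total τ *
          forestProb (n + m + 1) (shift n i (corner n k)) j σ := by
      intro n
      refine forestProb_succ (n := n + m + 1) (i := 0) j τ fun S hS => ?_
      have := neighborSet_glue_of_unique hS (i := 0) (v := shift n i (corner n k))
        fun l hl q _ => by
          rw [shift_zero]
          exact shift_ne_mid (by omega) hik hl q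
      rwa [shift_zero] at this
    simp only [hrec]
    have h := tendsto_finsetSum Finset.univ fun σ _ =>
      (ih σ).const_mul ((transfer 0 τ σ : ℝ) / total τ)
    rwa [← Finset.sum_mul, sum_transfer, one_mul] at h

/-! ### Spanning trees as forests -/

theorem reachable_map_iff {V W : Type*} (f : V ↪ W) (T : SimpleGraph V) {u v : V} :
    (T.map f).Reachable (f u) (f v) ↔ T.Reachable u v := by
  constructor
  · have : ∀ w, (T.map f).Reachable (f u) w → ∃ w', f w' = w ∧ T.Reachable u w' := by
      intro w hw
      rw [SimpleGraph.reachable_iff_reflTransGen] at hw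
      induction hw with
      | refl => exact ⟨u, rfl, SimpleGraph.Reachable.refl _⟩
      | tail _ hab ih =>
        obtain ⟨a', rfl, ha⟩ := ih
        obtain ⟨a, b, hadj, he, rfl⟩ := (SimpleGraph.map_adj ..).1 hab
        rw [f.injective he] at hadj
        exact ⟨b, rfl, ha.trans hadj.reachable⟩
    intro h
    obtain ⟨w, hw, h⟩ := this _ h
    rwa [f.injective hw] at h
  · exact fun h => h.map (SimpleGraph.Embedding.map f T).toHom

/-- The inclusion of the vertices in the lattice. -/
def incl (n : ℕ) : Vertex n ↪ ℕ × ℕ := Function.Embedding.subtype _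

/-- Rootedness with all corners in one block is connectedness, and a connected graph with one edge
fewer than vertices is a tree. -/
theorem isForest_map_iff {n : ℕ} {T : SimpleGraph (Vertex n)} :
    IsForest n 0 (T.map (incl n)) ↔ IsSpanningTree (SG n) T := by
  have hr : ∀ (u v : Vertex n), (T.map (incl n)).Reachable u.1 v.1 ↔ T.Reachable u v :=
    fun u v => reachable_map_iff (incl n) T
  have hsame : ∀ x y, same 0 x y = true := by decide
  have hcard : Nat.card (Vertex n) = (verts n).card := by
    rw [Nat.card_eq_fintype_card, Fintype.card_coe]
  have hle : T.map (incl n) ≤ bonds n ↔ T ≤ SG n := SimpleGraph.map_le_iff_le_comap _ _ _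
  have hblocks : blocks 0 = 1 := rfl
  rw [IsForest, IsSpanningTree, SimpleGraph.isTree_iff_connected_and_card, hle, hcard, hblocks,
    SimpleGraph.edgeSet_map, Set.ncard_image_of_injective _ (Function.Embedding.injective _),
    Nat.card_coe_set_eq, ← and_assoc (a := Rooted n _)]
  refine and_congr_right fun _ => and_congr_left fun _ => ?_
  constructor
  · rintro ⟨hroot, htype⟩
    refine (SimpleGraph.connected_iff_exists_forall_reachable T).2 ⟨⟨_, corner_mem n 0⟩, ?_⟩
    rintro ⟨v, hv⟩
    obtain ⟨i, hi⟩ := hroot v hv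
    exact (hr _ _).1 (((htype 0 i).2 (hsame 0 i)).trans hi)
  · intro hc
    refine ⟨fun v hv => ⟨0, (hr ⟨_, corner_mem n 0⟩ ⟨v, hv⟩).2 (hc.preconnected _ _)⟩,
      fun x y => ?_⟩
    simp only [hsame, iff_true]
    exact (hr ⟨_, corner_mem n x⟩ ⟨_, corner_mem n y⟩).2 (hc.preconnected _ _)

theorem map_comap_incl {n : ℕ} {S : SimpleGraph (ℕ × ℕ)} (h : S ≤ bonds n) :
    (S.comap (incl n)).map (incl n) = S := by
  refine le_antisymm (SimpleGraph.map_comap_le _ _) fun u v huv => ?_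
  exact (SimpleGraph.map_adj ..).2 ⟨⟨u, mem_verts_of_adj (h huv)⟩,
    ⟨v, mem_verts_of_adj (h huv).symm⟩, huv, rfl, rfl⟩

theorem ncard_spanningTrees (n : ℕ) (P : SimpleGraph (ℕ × ℕ) → Prop) [DecidablePred P] :
    {T : SimpleGraph (Vertex n) | IsSpanningTree (SG n) T ∧ P (T.map (incl n))}.ncard =
      ((forests n 0).filter P).card := by
  rw [← Set.ncard_image_of_injective _ (SimpleGraph.map_injective (incl n)),
    ← Set.ncard_coe_finset]
  congr 1
  ext S
  simp only [Set.mem_image, Set.mem_ofPred_eq, Finset.coe_filter, mem_forests]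
  constructor
  · rintro ⟨T, ⟨hT, hP⟩, rfl⟩
    exact ⟨isForest_map_iff.2 hT, hP⟩
  · rintro ⟨hS, hP⟩
    have h := map_comap_incl hS.1
    exact ⟨S.comap (incl n), ⟨isForest_map_iff.1 (by rwa [h]), by rwa [h]⟩, h⟩

theorem numTrees_eq (n : ℕ) : (numTrees n : ℝ) = numForests n 0 := by
  have := ncard_spanningTrees n fun _ => True
  simp only [and_true, Finset.filter_true] at this
  rw [numTrees, this, numForests, Finset.sum_const, nsmul_eq_mul, mul_one]

theorem numTreesDeg_eq (j n : ℕ) (x : Vertex n) :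
    (numTreesDeg j n x : ℝ) = numForestsDeg n x.1 j 0 := by
  have := ncard_spanningTrees n fun S => (S.neighborSet x.1).ncard = j
  rw [numForestsDeg]
  simp only [hasDegree]
  rw [Finset.sum_boole, ← this, numTreesDeg]
  congr 3
  ext T
  have hx : (T.map (incl n)).neighborSet x.1 = incl n '' T.neighborSet x :=
    SimpleGraph.neighborSet_map T (incl n) x
  have hd : ∀ (_ : Fintype (T.neighborSet x)), T.degree x = (T.neighborSet x).ncard := by
    intro _
    rw [← Nat.card_coe_set_eq, Nat.card_eq_fintype_card, SimpleGraph.card_neighborSet_eq_degree]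
  rw [hx, Set.ncard_image_of_injective _ (incl n).injective, hd]

theorem degProb_eq (j n : ℕ) (x : Vertex n) : degProb j n x = forestProb n x.1 j 0 := by
  rw [degProb, numTrees_eq, numTreesDeg_eq, forestProb]

theorem tendsto_degProb (j m : ℕ) (x : (n : ℕ) → Vertex (n + m + 1))
    (hx : ∀ n, x n = vertexA n m ∨ x n = vertexB n m ∨ x n = vertexC n m) :
    Tendsto (fun n : ℕ => degProb j (n + m + 1) (x n)) atTop (𝓝 (midLimit j)) := by
  have hA := tendsto_forestProb_mid_add (i := 0) (k := 1) (by decide) j m 0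
  have hB := tendsto_forestProb_mid_add (i := 0) (k := 2) (by decide) j m 0
  have hC := tendsto_forestProb_mid_add (i := 1) (k := 2) (by decide) j m 0
  rw [tendsto_def] at hA hB hC ⊢
  intro s hs
  -- The choice among the three vertices may vary with `n`, so all three limits are applied to the
  -- same neighbourhood.
  filter_upwards [hA s hs, hB s hs, hC s hs] with n h1 h2 h3
  simp only [Set.mem_preimage, degProb_eq] at h1 h2 h3 ⊢
  rcases hx n with h | h | h <;> rw [h]
  · simpa [shift_apply, corner, vertexA] using h1
  · simpa [shift_apply, corner, vertexB] using h2
  · simpa [shift_apply, corner, vertexC] using h3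

end SierpinskiGasket

theorem mainTheorem4 (m : ℕ) (x : (n : ℕ) → SierpinskiGasket.Vertex (n + m + 1))
    (hx : ∀ n, x n = SierpinskiGasket.vertexA n m ∨ x n = SierpinskiGasket.vertexB n m ∨
      x n = SierpinskiGasket.vertexC n m) :
    Tendsto (fun n : ℕ => SierpinskiGasket.degProb 1 (n + m + 1) (x n)) atTop (𝓝 0) ∧
    Tendsto (fun n : ℕ => SierpinskiGasket.degProb 2 (n + m + 1) (x n)) atTop
      (𝓝 (121 / 196)) ∧
    Tendsto (fun n : ℕ => SierpinskiGasket.degProb 3 (n + m + 1) (x n)) atTop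
      (𝓝 (33 / 98)) ∧
    Tendsto (fun n : ℕ => SierpinskiGasket.degProb 4 (n + m + 1) (x n)) atTop
      (𝓝 (9 / 196)) := by
  have h := fun j => SierpinskiGasket.tendsto_degProb j m x hx
  have e : ∀ j, SierpinskiGasket.midLimit j = ∑ k ∈ Finset.range (j + 1),
      SierpinskiGasket.cornerLimit k * SierpinskiGasket.cornerLimit (j - k) := fun j =>
    Finset.Nat.sum_antidiagonal_eq_sum_range_succ_mk _ j
  -- The four values are the coefficients of the square of (11/14) X + (3/14) X^2.
  refine ⟨?_, ?_, ?_, ?_⟩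
  · convert h 1 using 2
    norm_num [e, Finset.sum_range_succ, SierpinskiGasket.cornerLimit]
  · convert h 2 using 2
    norm_num [e, Finset.sum_range_succ, SierpinskiGasket.cornerLimit]
  · convert h 3 using 2
    norm_num [e, Finset.sum_range_succ, SierpinskiGasket.cornerLimit]
  · convert h 4 using 2
    norm_num [e, Finset.sum_range_succ, SierpinskiGasket.cornerLimit]
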